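/- Let $(Q,\mathfrak n,\Bbbk)$ be a complete regular local ring whose residue field $\Bbbk$ is algebraically closed, let $d\ge 2$ be an integer not divisible by the characteristic of $\Bbbk$, and let $\omega$ be a primitive $2d$-th root of unity in $\mathbb C$. Assume that $Q$ is a $\mathbb Z[\omega]$-algebra, and write $\omega\in Q$ also for the image of $\omega$. For $h\in Q$, let $\mathrm{MF}_d(h)$ be the category of matrix factorizations of $h$ with $d$ factors: an object is a finitely generated projective $\mathbb Z_d$-graded $Q$-module $X=\bigoplus_{k\in\mathbb Z_d}X_k$ (where $\mathbb Z_d=\mathbb Z/d\mathbb Z$) with a $Q$-linear map $\phi:X\to X$ of degree $-1$ such that $\phi^d=h\cdot 1_X$; a morphism is a $Q$-linear map of degree $0$ that commutes with the structure maps; direct sums are formed componentwise. The $i$-th shift $T^iX$, $i\in\mathbb Z_d$, has the same structure map and $(T^iX)_k=X_{k+i}$; $T=T^1$. For $f,g\in Q$, $(X,\phi)\in\mathrm{MF}_d(f)$, $(Y,\psi)\in\mathrm{MF}_d(g)$ and $\zeta=\omega^2$, the tensor product $X\otimes_\zeta Y\in\mathrm{MF}_d(f+g)$ is the module $X\otimes_QY$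 with $(X\otimes_\zeta Y)_k=\bigoplus_{i+j=k}X_i\otimes_QY_j$ and the structure map $\Phi(x\otimes y)=\phi(x)\otimes y+\zeta^{|x|}x\otimes\psi(y)$ for homogeneous $x$ (of degree $|x|$) and $y$. Let $f,g\in\mathfrak n^2$ be nonzero, and let $X\in\mathrm{MF}_d(f)$ and $Y\in\mathrm{MF}_d(g)$ satisfy $TX\cong X$ and $TY\cong Y$ (isomorphic, not necessarily equal). Then there exists $Z\in\mathrm{MF}_d(f+g)$ such that $$X\otimes_{\omega^2}Y\;\cong\;\bigoplus_{i\in\mathbb Z_d}T^iZ\qquad\text{in }\mathrm{MF}_d(f+g).$$ -/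

import Mathlib

open CategoryTheory TensorProduct

universe u v

/-- `z` is the image of a primitive `n`-th root of unity `ζ ∈ ℂ` under some unital ring
homomorphism `ℤ[ζ] → Q`; in other words, `Q` is a `ℤ[ζ]`-algebra and `z` denotes `ζ` in `Q`. -/
def IsPrimitiveRootImage {Q : Type u} [CommRing Q] (n : ℕ) (z : Q) : Prop :=
  ∃ ζ : ℂ, IsPrimitiveRoot ζ n ∧ ∃ ρ : Algebra.adjoin ℤ ({ζ} : Set ℂ) →+* Q,
    ρ ⟨ζ, Algebra.self_mem_adjoin_singleton ℤ ζ⟩ = z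

theorem IsPrimitiveRootImage.sq {Q : Type u} [CommRing Q] {d : ℕ} [NeZero d] {w : Q}
    (hw : IsPrimitiveRootImage (2 * d) w) : IsPrimitiveRootImage d (w ^ 2) := by
  obtain ⟨ω, hω, ρ, rfl⟩ := hw
  have hle : Algebra.adjoin ℤ ({ω ^ 2} : Set ℂ) ≤ Algebra.adjoin ℤ ({ω} : Set ℂ) := by
    rw [Algebra.adjoin_le_iff, Set.singleton_subset_iff]
    exact pow_mem (Algebra.self_mem_adjoin_singleton ℤ ω) 2
  refine ⟨ω ^ 2, hω.pow (by have := NeZero.pos d; omega) rfl,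
    ρ.comp (Subalgebra.inclusion hle).toRingHom, ?_⟩
  rw [← map_pow]
  rfl

theorem IsPrimitiveRootImage.pow_eq_one {Q : Type u} [CommRing Q] {d : ℕ} {z : Q}
    (hz : IsPrimitiveRootImage d z) : z ^ d = 1 := by
  obtain ⟨ζ, hζ, ρ, rfl⟩ := hz
  rw [← map_pow, ← map_one ρ]
  congr 1
  exact Subtype.ext hζ.pow_eq_one

/-- Gaussian binomial coefficients, through their Pascal recursion. -/
def gaussBinom {R : Type u} [CommRing R] (q : R) : ℕ → ℕ → R
  | _, 0 => 1
  | 0, _ + 1 => 0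
  | n + 1, k + 1 => gaussBinom q n k + q ^ (k + 1) * gaussBinom q n (k + 1)

theorem gaussBinom_zero_right {R : Type u} [CommRing R] (q : R) (n : ℕ) :
    gaussBinom q n 0 = 1 := by
  cases n <;> rfl

theorem gaussBinom_eq_zero {R : Type u} [CommRing R] (q : R) :
    ∀ n k : ℕ, n < k → gaussBinom q n k = 0
  | _, 0, h => absurd h (Nat.not_lt_zero _)
  | 0, _ + 1, _ => rfl
  | n + 1, k + 1, h => by
    rw [gaussBinom, gaussBinom_eq_zero q n k (by omega),
      gaussBinom_eq_zero q n (k + 1) (by omega)]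
    simp

theorem gaussBinom_self {R : Type u} [CommRing R] (q : R) (n : ℕ) :
    gaussBinom q n n = 1 := by
  induction n with
  | zero => rfl
  | succ n ih => rw [gaussBinom, ih, gaussBinom_eq_zero q n (n + 1) (by omega)]; simp

theorem map_gaussBinom {R S : Type*} [CommRing R] [CommRing S] (ρ : R →+* S) (q : R) :
    ∀ n k : ℕ, ρ (gaussBinom q n k) = gaussBinom (ρ q) n k
  | n, 0 => by simp [gaussBinom_zero_right]
  | 0, _ + 1 => by simp [gaussBinom]
  | n + 1, k + 1 => by
    simp [gaussBinom, map_gaussBinom ρ q n k, map_gaussBinom ρ q n (k + 1)]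

theorem gaussBinom_mul {R : Type u} [CommRing R] (q : R) (n k : ℕ) (hk : k ≤ n) :
    gaussBinom q n k * ∏ i ∈ Finset.range k, (1 - q ^ (i + 1)) =
      ∏ i ∈ Finset.range k, (1 - q ^ (n - i)) := by
  induction n generalizing k with
  | zero =>
    obtain rfl : k = 0 := by omega
    simp [gaussBinom]
  | succ n ih =>
    cases k with
    | zero => simp [gaussBinom]
    | succ k =>
      have e1 := ih k (by omega)
      have e3 : ∏ i ∈ Finset.range (k + 1), (1 - q ^ (n + 1 - i)) =
          (∏ i ∈ Finset.range k, (1 - q ^ (n - i))) * (1 - q ^ (n + 1)) := by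
        rw [Finset.prod_range_succ']
        simp
      have e2 : gaussBinom q n (k + 1) * ∏ i ∈ Finset.range (k + 1), (1 - q ^ (i + 1)) =
          (∏ i ∈ Finset.range k, (1 - q ^ (n - i))) * (1 - q ^ (n - k)) := by
        rcases Nat.lt_or_ge n (k + 1) with h | h
        · obtain rfl : n = k := by omega
          rw [gaussBinom_eq_zero q n (n + 1) h]
          simp
        · rw [ih (k + 1) h, Finset.prod_range_succ]
      have e4 : q ^ (k + 1) * q ^ (n - k) = q ^ (n + 1) := by
        rw [← pow_add]
        congr 1
        omega
      rw [gaussBinom, add_mul, mul_assoc, e2, e3, Finset.prod_range_succ, ← mul_assoc, e1]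
      linear_combination (-(∏ i ∈ Finset.range k, (1 - q ^ (n - i)))) * e4

theorem IsPrimitiveRootImage.gaussBinom {Q : Type u} [CommRing Q] {d : ℕ} {z : Q}
    (hz : IsPrimitiveRootImage d z) (k : ℕ) (hk0 : 0 < k) (hkd : k < d) :
    gaussBinom z d k = 0 := by
  obtain ⟨ζ, hζ, ρ, rfl⟩ := hz
  rw [← map_gaussBinom]
  convert map_zero ρ
  apply Subtype.val_injective
  have h := map_gaussBinom (Algebra.adjoin ℤ ({ζ} : Set ℂ)).val.toRingHom
    ⟨ζ, Algebra.self_mem_adjoin_singleton ℤ ζ⟩ d k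
  refine h.trans ?_
  change _root_.gaussBinom ζ d k = 0
  have h1 := gaussBinom_mul ζ d k hkd.le
  have h2 : ∏ i ∈ Finset.range k, (1 - ζ ^ (d - i)) = 0 :=
    Finset.prod_eq_zero (Finset.mem_range.2 hk0) (by simp [hζ.pow_eq_one])
  rw [h2] at h1
  refine (mul_eq_zero.1 h1).resolve_right (Finset.prod_ne_zero_iff.2 fun i hi => ?_)
  rw [sub_ne_zero]
  exact (hζ.pow_ne_one_of_pos_of_lt (by omega)
    (by have := Finset.mem_range.1 hi; omega)).symm

theorem add_pow_of_qcommute {Q : Type u} [CommRing Q] {E : Type v} [Ring E] [Algebra Q E]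
    (q : Q) (a b : E) (hab : a * b = q • (b * a)) (n : ℕ) :
    (a + b) ^ n = ∑ k ∈ Finset.range (n + 1), gaussBinom q n k • (b ^ k * a ^ (n - k)) := by
  have hc : ∀ k : ℕ, a * b ^ k = q ^ k • (b ^ k * a) := by
    intro k
    induction k with
    | zero => simp
    | succ k ih =>
      rw [pow_succ b, ← mul_assoc, ih, smul_mul_assoc, mul_assoc, hab, mul_smul_comm, smul_smul,
        ← pow_succ, mul_assoc]
  induction n with
  | zero => simp [gaussBinom]
  | succ n ih =>
    have hA : ∀ k ∈ Finset.range (n + 1),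
        a * (gaussBinom q n k • (b ^ k * a ^ (n - k))) =
          (q ^ k * gaussBinom q n k) • (b ^ k * a ^ (n + 1 - k)) := by
      intro k hk
      have hk' : n + 1 - k = (n - k) + 1 := by have := Finset.mem_range.1 hk; omega
      rw [mul_smul_comm, ← mul_assoc, hc, smul_mul_assoc, smul_smul, hk', pow_succ', mul_assoc,
        mul_comm (gaussBinom q n k)]
    have hB : ∀ k ∈ Finset.range (n + 1),
        b * (gaussBinom q n k • (b ^ k * a ^ (n - k))) =
          gaussBinom q n k • (b ^ (k + 1) * a ^ (n + 1 - (k + 1))) := by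
      intro k _
      rw [mul_smul_comm, ← mul_assoc, ← pow_succ', Nat.add_sub_add_right]
    rw [pow_succ', ih, add_mul, Finset.mul_sum, Finset.mul_sum, Finset.sum_congr rfl hA,
      Finset.sum_congr rfl hB, Finset.sum_range_succ' _ (n + 1)]
    simp only [gaussBinom, add_smul, Finset.sum_add_distrib]
    rw [add_assoc, add_comm]
    congr 1
    rw [Finset.sum_range_succ', Finset.sum_range_succ _ n,
      gaussBinom_eq_zero q n (n + 1) (by omega)]
    simp [gaussBinom_zero_right]

theorem add_pow_of_rootImage {Q : Type u} [CommRing Q] {E : Type v} [Ring E] [Algebra Q E]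
    {d : ℕ} [NeZero d] {z : Q} (hz : IsPrimitiveRootImage d z) (a b : E)
    (hab : a * b = z • (b * a)) : (a + b) ^ d = a ^ d + b ^ d := by
  rw [add_pow_of_qcommute z a b hab, Finset.sum_range_succ, gaussBinom_self]
  have h0 : d ≠ 0 := NeZero.ne d
  rw [Finset.sum_eq_single_of_mem 0 (Finset.mem_range.2 (Nat.pos_of_ne_zero h0))]
  · simp [gaussBinom_zero_right]
  · intro k hk hk0
    rw [hz.gaussBinom k (Nat.pos_of_ne_zero hk0) (Finset.mem_range.1 hk), zero_smul]

theorem isInternal_of_projections {Q : Type u} [CommRing Q] {M : Type v} [AddCommGroup M]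
    [Module Q M] {ι : Type*} [Fintype ι] [DecidableEq ι] (N : ι → Submodule Q M)
    (π : ι → M →ₗ[Q] M) (h1 : ∀ i x, π i x ∈ N i) (h2 : ∀ i, ∀ x ∈ N i, π i x = x)
    (h3 : ∀ i j, i ≠ j → ∀ x ∈ N i, π j x = 0) (h4 : ∀ x, ∑ i, π i x = x) :
    DirectSum.IsInternal N := by
  rw [DirectSum.isInternal_submodule_iff_iSupIndep_and_iSup_eq_top]
  constructor
  · rw [iSupIndep_def]
    intro j
    rw [Submodule.disjoint_def]
    intro x hx hx'
    rw [← h2 j x hx]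
    have : (⨆ i, ⨆ (_ : i ≠ j), N i) ≤ LinearMap.ker (π j) :=
      iSup₂_le fun i hij y hy => h3 i j hij y hy
    exact this hx'
  · rw [eq_top_iff]
    intro x _
    rw [← h4 x]
    exact Submodule.sum_mem _ fun i _ => Submodule.mem_iSup_of_mem i (h1 i x)

/-- A matrix factorization of `f` with `d` factors: a `ℤ/d`-graded finitely generated projective
`Q`-module `X = ⨁ₖ Xₖ` with a `Q`-linear map `φ : X → X` of degree `-1` such that `φ ^ d = f`.
(The total module is finitely generated projective if and only if every piece `Xₖ` is, and the
restriction of `φ` to `Xₖ` is the map `φₖ : Xₖ → Xₖ₋₁`.) -/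
structure MatrixFactorization (Q : Type u) [CommRing Q] (d : ℕ) (f : Q) where
  carrier : Type v
  [addCommGroup : AddCommGroup carrier]
  [module : Module Q carrier]
  [finite : Module.Finite Q carrier]
  [projective : Module.Projective Q carrier]
  /-- the homogeneous pieces `Xₖ` -/
  piece : ZMod d → Submodule Q carrier
  isInternal : DirectSum.IsInternal piece
  /-- the structure map `φ` -/
  φ : carrier →ₗ[Q] carrier
  φ_mem : ∀ (k : ZMod d) (x : carrier), x ∈ piece k → φ x ∈ piece (k - 1)
  φ_pow : φ ^ d = f • LinearMap.id

namespace MatrixFactorization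

attribute [instance] addCommGroup module finite projective

variable {Q : Type u} [CommRing Q] {d : ℕ} {f g : Q}

/-- A morphism: a `Q`-linear map of degree zero that commutes with the structure maps. -/
@[ext]
structure Hom (X Y : MatrixFactorization.{u, v} Q d f) where
  toLinearMap : X.carrier →ₗ[Q] Y.carrier
  map_mem : ∀ (k : ZMod d) (x : X.carrier), x ∈ X.piece k → toLinearMap x ∈ Y.piece k
  comm : toLinearMap ∘ₗ X.φ = Y.φ ∘ₗ toLinearMap

/-- The category of matrix factorizations of `f` with `d` factors. -/
instance : Category (MatrixFactorization.{u, v} Q d f) where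
  Hom X Y := Hom X Y
  id X := ⟨LinearMap.id, fun _ _ h => h, rfl⟩
  comp α β := ⟨β.toLinearMap ∘ₗ α.toLinearMap,
    fun k x h => β.map_mem k _ (α.map_mem k x h), by
      rw [LinearMap.comp_assoc, α.comm, ← LinearMap.comp_assoc, β.comm, LinearMap.comp_assoc]⟩

/-- The `i`-th shift `Tⁱ X`, with `(Tⁱ X)ₖ = Xₖ₊ᵢ` and the same structure map. -/
def shift (X : MatrixFactorization.{u, v} Q d f) (i : ZMod d) :
    MatrixFactorization.{u, v} Q d f where
  carrier := X.carrier
  piece k := X.piece (k + i)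
  isInternal := by
    have h := X.isInternal
    rw [DirectSum.isInternal_submodule_iff_iSupIndep_and_iSup_eq_top] at h ⊢
    refine ⟨h.1.comp (add_left_injective i), ?_⟩
    rw [← h.2]
    exact (Equiv.addRight i).iSup_comp (g := X.piece)
  φ := X.φ
  φ_mem k x hx := by
    have := X.φ_mem _ x hx
    rwa [add_sub_right_comm] at this
  φ_pow := X.φ_pow

/-- The decomposition of `X` as the direct sum of its pieces. -/
noncomputable def decompose (X : MatrixFactorization.{u, v} Q d f) :
    DirectSum (ZMod d) (fun i => X.piece i) ≃ₗ[Q] X.carrier :=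
  LinearEquiv.ofBijective (DirectSum.coeLinearMap X.piece) X.isInternal

/-- The projection of `X` onto its piece `Xₖ`, as an endomorphism of `X`. -/
noncomputable def proj (X : MatrixFactorization.{u, v} Q d f) (k : ZMod d) :
    X.carrier →ₗ[Q] X.carrier :=
  (X.piece k).subtype ∘ₗ DirectSum.component Q (ZMod d) (fun i => X.piece i) k ∘ₗ
    X.decompose.symm.toLinearMap

theorem proj_mem (X : MatrixFactorization.{u, v} Q d f) (k : ZMod d) (x : X.carrier) :
    X.proj k x ∈ X.piece k :=
  Subtype.property _

theorem decompose_symm_of_mem (X : MatrixFactorization.{u, v} Q d f) {k : ZMod d}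
    {x : X.carrier} (hx : x ∈ X.piece k) :
    X.decompose.symm x = DirectSum.lof Q (ZMod d) (fun i => X.piece i) k ⟨x, hx⟩ := by
  rw [LinearEquiv.symm_apply_eq]
  exact (DirectSum.coeLinearMap_lof X.piece k ⟨x, hx⟩).symm

theorem proj_of_mem (X : MatrixFactorization.{u, v} Q d f) {k : ZMod d} {x : X.carrier}
    (hx : x ∈ X.piece k) : X.proj k x = x := by
  simp [proj, X.decompose_symm_of_mem hx, DirectSum.component.lof_self]

theorem proj_of_mem_ne (X : MatrixFactorization.{u, v} Q d f) {k l : ZMod d} (hkl : k ≠ l)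
    {x : X.carrier} (hx : x ∈ X.piece k) : X.proj l x = 0 := by
  simp [proj, X.decompose_symm_of_mem hx, DirectSum.component.of, hkl]

theorem induction_piece (X : MatrixFactorization.{u, v} Q d f) {p : X.carrier → Prop}
    (x : X.carrier) (h0 : p 0) (hadd : ∀ x y, p x → p y → p (x + y))
    (hp : ∀ k, ∀ x ∈ X.piece k, p x) : p x := by
  have hx : x ∈ ⨆ k, X.piece k := by
    rw [X.isInternal.submodule_iSup_eq_top]
    trivial
  exact Submodule.iSup_induction X.piece (motive := p) hx hp h0 hadd

theorem hom_ext_piece (X : MatrixFactorization.{u, v} Q d f) {M : Type*} [AddCommGroup M]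
    [Module Q M] {α β : X.carrier →ₗ[Q] M} (h : ∀ k, ∀ x ∈ X.piece k, α x = β x) : α = β := by
  ext x
  induction x using X.induction_piece with
  | h0 => simp
  | hadd x y hx hy => simp [hx, hy]
  | hp k x hx => exact h k x hx

/-- The pieces of the tensor product: `(X ⊗ Y)ₖ = ⨁_{i + j = k} Xᵢ ⊗ Yⱼ`, where `Xᵢ ⊗ Yⱼ` is
identified with its image in `X ⊗ Y` (it is a direct summand). -/
def tensorPiece (X : MatrixFactorization.{u, v} Q d f) (Y : MatrixFactorization.{u, v} Q d g)
    (k : ZMod d) : Submodule Q (X.carrier ⊗[Q] Y.carrier) :=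
  ⨆ (i : ZMod d) (j : ZMod d) (_ : i + j = k),
    LinearMap.range (TensorProduct.map (X.piece i).subtype (Y.piece j).subtype)

theorem tmul_mem_tensorPiece (X : MatrixFactorization.{u, v} Q d f)
    (Y : MatrixFactorization.{u, v} Q d g) {i j k : ZMod d} (hij : i + j = k) {x : X.carrier}
    {y : Y.carrier} (hx : x ∈ X.piece i) (hy : y ∈ Y.piece j) :
    x ⊗ₜ[Q] y ∈ X.tensorPiece Y k :=
  Submodule.mem_iSup_of_mem i (Submodule.mem_iSup_of_mem j (Submodule.mem_iSup_of_mem hij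
    ⟨(⟨x, hx⟩ : X.piece i) ⊗ₜ[Q] (⟨y, hy⟩ : Y.piece j), rfl⟩))

theorem tensorPiece_le (X : MatrixFactorization.{u, v} Q d f)
    (Y : MatrixFactorization.{u, v} Q d g) (k : ZMod d)
    (P : Submodule Q (X.carrier ⊗[Q] Y.carrier))
    (h : ∀ i j, i + j = k → ∀ x ∈ X.piece i, ∀ y ∈ Y.piece j, x ⊗ₜ[Q] y ∈ P) :
    X.tensorPiece Y k ≤ P := by
  refine iSup_le fun i => iSup_le fun j => iSup_le fun hij => ?_
  rintro _ ⟨t, rfl⟩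
  induction t using TensorProduct.induction_on with
  | zero => simp
  | tmul x y => exact h i j hij x x.2 y y.2
  | add s t hs ht => rw [map_add]; exact P.add_mem hs ht

variable [NeZero d]

theorem sum_proj (X : MatrixFactorization.{u, v} Q d f) (x : X.carrier) :
    ∑ k, X.proj k x = x := by
  induction x using X.induction_piece with
  | h0 => simp
  | hadd x y hx hy => simp only [map_add, Finset.sum_add_distrib, hx, hy]
  | hp k x hx =>
    rw [Finset.sum_eq_single k (fun l _ hl => X.proj_of_mem_ne hl.symm hx) (by simp),
      X.proj_of_mem hx]

/-- The map `x ↦ z ^ |x| x` for homogeneous `x` (well defined if `z ^ d = 1`). -/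
noncomputable def twist (X : MatrixFactorization.{u, v} Q d f) (z : Q) :
    X.carrier →ₗ[Q] X.carrier :=
  ∑ k : ZMod d, z ^ k.val • X.proj k

theorem twist_of_mem (X : MatrixFactorization.{u, v} Q d f) (z : Q) {k : ZMod d}
    {x : X.carrier} (hx : x ∈ X.piece k) : X.twist z x = z ^ k.val • x := by
  simp only [twist, LinearMap.sum_apply, LinearMap.smul_apply]
  rw [Finset.sum_eq_single k (fun l _ hl => by rw [X.proj_of_mem_ne hl.symm hx, smul_zero])
    (by simp), X.proj_of_mem hx]

theorem φ_twist (X : MatrixFactorization.{u, v} Q d f) {z : Q} (hz : z ^ d = 1) :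
    X.φ ∘ₗ X.twist z = z • X.twist z ∘ₗ X.φ := by
  refine X.hom_ext_piece fun k x hx => ?_
  simp only [LinearMap.comp_apply, LinearMap.smul_apply, X.twist_of_mem z hx,
    X.twist_of_mem z (X.φ_mem k x hx), map_smul, smul_smul, ← pow_succ']
  congr 1
  rw [pow_eq_pow_mod k.val hz, pow_eq_pow_mod (_ + 1) hz]
  congr 1
  change k.val ≡ _ [MOD d]
  rw [← ZMod.natCast_eq_natCast_iff]
  simp

theorem twist_pow (X : MatrixFactorization.{u, v} Q d f) {z : Q} (hz : z ^ d = 1) :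
    X.twist z ^ d = 1 := by
  refine X.hom_ext_piece fun k x hx => ?_
  have : ∀ n : ℕ, (X.twist z ^ n) x = (z ^ k.val) ^ n • x := by
    intro n
    induction n with
    | zero => simp
    | succ n ih =>
      rw [pow_succ', Module.End.mul_apply, ih, map_smul, X.twist_of_mem z hx, smul_smul, pow_succ]
  rw [this, ← pow_mul, mul_comm, pow_mul, hz]
  simp

theorem tensorPiece_isInternal (X : MatrixFactorization.{u, v} Q d f)
    (Y : MatrixFactorization.{u, v} Q d g) : DirectSum.IsInternal (X.tensorPiece Y) := by
  have key : ∀ i j k : ZMod d, ∀ x ∈ X.piece i, ∀ y ∈ Y.piece j,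
      (∑ l, TensorProduct.map (X.proj l) (Y.proj (k - l))) (x ⊗ₜ[Q] y) =
        if i + j = k then x ⊗ₜ[Q] y else 0 := by
    intro i j k x hx y hy
    simp only [LinearMap.sum_apply, TensorProduct.map_tmul]
    rw [Finset.sum_eq_single i
      (fun l _ hl => by rw [X.proj_of_mem_ne hl.symm hx, TensorProduct.zero_tmul]) (by simp),
      X.proj_of_mem hx]
    split_ifs with h
    · rw [← h, add_sub_cancel_left, Y.proj_of_mem hy]
    · rw [Y.proj_of_mem_ne (fun h' => h (by rw [h']; ring)) hy, TensorProduct.tmul_zero]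
  refine isInternal_of_projections _
    (fun k => ∑ l, TensorProduct.map (X.proj l) (Y.proj (k - l))) ?_ ?_ ?_ ?_
  · intro k t
    induction t using TensorProduct.induction_on with
    | zero => simp
    | tmul x y =>
      simp only [LinearMap.sum_apply, TensorProduct.map_tmul]
      exact Submodule.sum_mem _ fun l _ =>
        X.tmul_mem_tensorPiece Y (by ring) (X.proj_mem _ _) (Y.proj_mem _ _)
    | add s t hs ht => rw [map_add]; exact Submodule.add_mem _ hs ht
  · intro k t ht
    have : X.tensorPiece Y k ≤ LinearMap.eqLocus
        (∑ l, TensorProduct.map (X.proj l) (Y.proj (k - l))) LinearMap.id :=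
      X.tensorPiece_le Y k _ fun i j hij x hx y hy => by
        rw [LinearMap.mem_eqLocus, key i j k x hx y hy, if_pos hij]
        rfl
    exact this ht
  · intro k l hkl t ht
    have : X.tensorPiece Y k ≤ LinearMap.ker
        (∑ m, TensorProduct.map (X.proj m) (Y.proj (l - m))) :=
      X.tensorPiece_le Y k _ fun i j hij x hx y hy => by
        rw [LinearMap.mem_ker, key i j l x hx y hy, if_neg (by rw [hij]; exact hkl)]
    exact this ht
  · intro t
    induction t using TensorProduct.induction_on with
    | zero => simp
    | tmul x y =>
      induction x using X.induction_piece with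
      | h0 => simp
      | hadd x x' hx hx' => simp only [TensorProduct.add_tmul, map_add, Finset.sum_add_distrib,
          hx, hx']
      | hp i x hx =>
        induction y using Y.induction_piece with
        | h0 => simp
        | hadd y y' hy hy' => simp only [TensorProduct.tmul_add, map_add, Finset.sum_add_distrib,
            hy, hy']
        | hp j y hy =>
          rw [Finset.sum_congr rfl fun k _ => key i j k x hx y hy]
          simp
    | add s t hs ht => simp only [map_add, Finset.sum_add_distrib, hs, ht]

/-- The structure map of the tensor product: `Φ (x ⊗ y) = φ x ⊗ y + z ^ |x| x ⊗ ψ y`. -/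
noncomputable def tensorMap (z : Q) (X : MatrixFactorization.{u, v} Q d f)
    (Y : MatrixFactorization.{u, v} Q d g) :
    X.carrier ⊗[Q] Y.carrier →ₗ[Q] X.carrier ⊗[Q] Y.carrier :=
  TensorProduct.map X.φ LinearMap.id + TensorProduct.map (X.twist z) Y.φ

theorem tensorMap_pow {z : Q} (hz : IsPrimitiveRootImage d z)
    (X : MatrixFactorization.{u, v} Q d f) (Y : MatrixFactorization.{u, v} Q d g) :
    tensorMap z X Y ^ d = (f + g) • LinearMap.id := by
  have hz1 := hz.pow_eq_one
  rw [tensorMap, add_pow_of_rootImage hz]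
  · rw [TensorProduct.map_pow, TensorProduct.map_pow, X.twist_pow hz1, X.φ_pow, Y.φ_pow,
      TensorProduct.map_smul_left, TensorProduct.map_smul_right, add_smul]
    congr 1
    · rw [show (LinearMap.id : Y.carrier →ₗ[Q] Y.carrier) = 1 from rfl, one_pow]
      exact congrArg _ TensorProduct.map_id
    · exact congrArg _ TensorProduct.map_id
  · rw [Module.End.mul_eq_comp, Module.End.mul_eq_comp, ← TensorProduct.map_comp,
      ← TensorProduct.map_comp, X.φ_twist hz1, TensorProduct.map_smul_left]
    rfl

/-- The tensor product `X ⊗_z Y` of matrix factorizations of `f` and `g`, with respect to the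
image `z ∈ Q` of a primitive `d`-th root of unity: a matrix factorization of `f + g`. -/
noncomputable def tensor {z : Q} (hz : IsPrimitiveRootImage d z)
    (X : MatrixFactorization.{u, v} Q d f) (Y : MatrixFactorization.{u, v} Q d g) :
    MatrixFactorization.{u, v} Q d (f + g) where
  carrier := X.carrier ⊗[Q] Y.carrier
  piece := X.tensorPiece Y
  isInternal := X.tensorPiece_isInternal Y
  φ := tensorMap z X Y
  φ_mem k t ht := by
    have : X.tensorPiece Y k ≤ (X.tensorPiece Y (k - 1)).comap (tensorMap z X Y) :=
      X.tensorPiece_le Y k _ fun i j hij x hx y hy => by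
        rw [Submodule.mem_comap, tensorMap, LinearMap.add_apply, TensorProduct.map_tmul,
          TensorProduct.map_tmul, X.twist_of_mem z hx]
        exact Submodule.add_mem _
          (X.tmul_mem_tensorPiece Y (by rw [← hij]; ring) (X.φ_mem i x hx) hy)
          (X.tmul_mem_tensorPiece Y (by rw [← hij]; ring) (Submodule.smul_mem _ _ hx)
            (Y.φ_mem j y hy))
    exact this ht
  φ_pow := tensorMap_pow hz X Y

/-- The direct sum of a finite family of matrix factorizations, with
`(⨁ᵢ Fᵢ)ₖ = ⨁ᵢ (Fᵢ)ₖ` and the structure map acting componentwise. -/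
noncomputable def directSum {ι : Type} [Fintype ι] (F : ι → MatrixFactorization.{u, v} Q d f) :
    MatrixFactorization.{u, v} Q d f where
  carrier := ∀ i, (F i).carrier
  projective := by
    classical
    exact Module.Projective.of_equiv (DirectSum.linearEquivFunOnFintype Q ι fun i => (F i).carrier)
  piece k := Submodule.pi Set.univ fun i => (F i).piece k
  isInternal := by
    refine isInternal_of_projections _
      (fun k => LinearMap.pi fun i => (F i).proj k ∘ₗ LinearMap.proj i) ?_ ?_ ?_ ?_
    · intro k x
      rw [Submodule.mem_pi]
      exact fun i _ => (F i).proj_mem k (x i)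
    · intro k x hx
      rw [Submodule.mem_pi] at hx
      funext i
      exact (F i).proj_of_mem (hx i trivial)
    · intro k l hkl x hx
      rw [Submodule.mem_pi] at hx
      funext i
      exact (F i).proj_of_mem_ne hkl (hx i trivial)
    · intro x
      funext i
      rw [Finset.sum_apply]
      exact (F i).sum_proj (x i)
  φ := LinearMap.pi fun i => (F i).φ ∘ₗ LinearMap.proj i
  φ_mem k x hx := by
    rw [Submodule.mem_pi] at hx ⊢
    exact fun i _ => (F i).φ_mem k (x i) (hx i trivial)
  φ_pow := by
    have : ∀ (n : ℕ) (x : ∀ i, (F i).carrier),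
        ((LinearMap.pi fun i => (F i).φ ∘ₗ LinearMap.proj i :
          (∀ i, (F i).carrier) →ₗ[Q] ∀ i, (F i).carrier) ^ n) x =
          fun i => ((F i).φ ^ n) (x i) := by
      intro n x
      induction n with
      | zero => rfl
      | succ n ih =>
        rw [pow_succ', Module.End.mul_apply, ih]
        funext i
        rw [pow_succ', Module.End.mul_apply]
        rfl
    ext1 x
    rw [this]
    funext i
    rw [(F i).φ_pow]
    rfl

end MatrixFactorization

/-! Write `z = ω ^ 2`. Isomorphisms `TX ≅ X` and `TY ≅ Y` are automorphisms `α`, `β` of the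
underlying modules that have degree `-1` and commute with the structure maps. Let `ρ` act on `Y` by
`y ↦ z ^ |y| y`. Then `A = α ⊗ ρ` and `B = 1 ⊗ β` are automorphisms of degree `-1` commuting with
the structure map of the tensor product, and `B A = z A B`. Hence `s = B⁻¹ A` is an automorphism of
degree `0` with `A s = z s A`.

Since `z ^ d = 1`, the power `s ^ d` commutes with `A`. Its inverse has a `d`-th root `v` in its
bicommutant: this is a finite commutative `Q`-algebra, where Hensel's lemma reduces root extraction
to a finite algebra over the algebraically closed residue field. Then `t = s v` satisfies `t ^ d =
1` and still `A t = z t A`.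

As `d` is invertible, `e = (1/d) ∑ t ^ j` is an idempotent, the projection onto the fixed part of
`t`. Its conjugates `A ^ i e A⁻ⁱ` are the projections onto the eigenspaces of `t`, so they are
orthogonal and sum to `1`. Each `A ^ i` has degree `-i`, so the `i`-th summand is `Tⁱ Z` for `Z = im
e`. The carrying lemmas are `exists_pow_eq_commute`, `exists_pow_eq_one_of_qcommute`,
`sum_conj_averagePow` and `exists_iso_directSum_shift`. -/

/-! ### Roots of units in finite algebras over a complete local ring. -/

theorem IsAdicComplete.of_linearEquiv {R : Type*} [CommRing R] (I : Ideal R) {M N : Type*}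
    [AddCommGroup M] [Module R M] [AddCommGroup N] [Module R N] [IsAdicComplete I M]
    (e : M ≃ₗ[R] N) : IsAdicComplete I N := by
  rw [← AdicCompletion.of_bijective_iff]
  have h : ⇑(AdicCompletion.of I N) =
      (AdicCompletion.congr I e) ∘ AdicCompletion.of I M ∘ e.symm := by
    funext x
    simp [AdicCompletion.map_of]
  rw [h]
  exact (LinearEquiv.bijective _).comp
    ((AdicCompletion.of_bijective I M).comp (LinearEquiv.bijective _))

/-- A finite module over a complete Noetherian ring is complete. -/
theorem isAdicComplete_of_finite {R : Type u} [CommRing R] [IsNoetherianRing R] (I : Ideal R)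
    [IsAdicComplete I R] (M : Type v) [AddCommGroup M] [Module R M] [Module.Finite R M] :
    IsAdicComplete I M := by
  -- The quotient of `Rⁿ` lives in the universe of `R`, unlike `M`.
  obtain ⟨n, S, ⟨e⟩⟩ := Module.Finite.exists_fin_quot_equiv R M
  suffices IsAdicComplete I (_ ⧸ S) from .of_linearEquiv I e
  rw [← AdicCompletion.of_bijective_iff]
  -- The completion map of a module `N` factors as `N ≅ R ⊗ N ≅ R^ ⊗ N → N^`; the last arrow is
  -- bijective for finite `N` over a Noetherian ring.
  have h : ⇑(AdicCompletion.of I (_ ⧸ S)) = AdicCompletion.ofTensorProduct I (_ ⧸ S) ∘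
      ((TensorProduct.lid R (_ ⧸ S)).symm.trans
        (TensorProduct.congr (AdicCompletion.ofLinearEquiv I R) (LinearEquiv.refl R _))) := by
    funext x
    have h1 : AdicCompletion.of I R 1 = 1 := rfl
    simp [AdicCompletion.ofTensorProduct_tmul, h1]
  rw [h]
  exact (AdicCompletion.ofTensorProduct_bijective_of_finite_of_isNoetherian I _).comp
    (LinearEquiv.bijective _)

/-- In a finite commutative algebra over an algebraically closed field, units have `d`-th roots. -/
theorem exists_pow_eq_of_isAlgClosed {k B : Type*} [Field k] [IsAlgClosed k] [CommRing B]
    [Algebra k B] [Module.Finite k B] {d : ℕ} (hd : (d : k) ≠ 0) {a : B} (ha : IsUnit a) :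
    ∃ b : B, b ^ d = a := by
  have hd0 : d ≠ 0 := by rintro rfl; simp at hd
  have : IsArtinianRing B := IsArtinianRing.of_finite k B
  -- Every residue field of `B` is finite over `k`, hence equal to `k`, where roots exist.
  have hroot : ∀ m : MaximalSpectrum B, ∃ b : B ⧸ m.asIdeal,
      b ^ d = Ideal.Quotient.mk m.asIdeal a := by
    intro m
    let := Ideal.Quotient.field m.asIdeal
    have : Module.Finite k (B ⧸ m.asIdeal) := Module.Finite.trans B _
    obtain ⟨c, hc⟩ := (IsAlgClosed.algebraMap_bijective_of_isIntegral (k := k)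
      (K := B ⧸ m.asIdeal)).2 (Ideal.Quotient.mk m.asIdeal a)
    obtain ⟨y, hy⟩ := IsAlgClosed.exists_pow_nat_eq c (Nat.pos_of_ne_zero hd0)
    exact ⟨algebraMap k _ y, by rw [← map_pow, hy, hc]⟩
  choose r hr using hroot
  -- Chinese remainder theorem: modulo its nilradical, `B` is the product of its residue fields.
  obtain ⟨b₀, hb₀⟩ : ∃ b : B, ∀ m : MaximalSpectrum B, Ideal.Quotient.mk m.asIdeal b = r m := by
    obtain ⟨q, hq⟩ := (IsArtinianRing.quotNilradicalEquivPi B).surjective r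
    obtain ⟨b, rfl⟩ := Ideal.Quotient.mk_surjective q
    exact ⟨b, fun m => congrFun hq m⟩
  have hnil : IsNilpotent (b₀ ^ d - a) := by
    rw [← mem_nilradical, IsArtinianRing.nilradical_eq_iInf, Submodule.mem_iInf]
    intro m
    rw [← Ideal.Quotient.eq, map_pow, hb₀, hr]
  have hdB : IsUnit (d : B) := by
    simpa using (IsUnit.mk0 (d : k) hd).map (algebraMap k B)
  have hu : IsUnit (b₀ ^ d) := by
    simpa using hnil.isUnit_add_right_of_commute ha (Commute.all _ _)
  -- Newton's method for `X ^ d - a` at `b₀`: the value is nilpotent and the derivative `d * b₀ ^ (d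
  -- - 1)` is a unit.
  obtain ⟨b, ⟨-, hb⟩, -⟩ := Polynomial.existsUnique_nilpotent_sub_and_aeval_eq_zero (R := B)
    (P := Polynomial.X ^ d - Polynomial.C a) (x := b₀) (by simpa using hnil)
    (by simpa [Polynomial.derivative_X_pow] using
      And.intro hdB (((isUnit_pow_iff hd0).1 hu).pow (d - 1)))
  exact ⟨b, by simpa [sub_eq_zero] using hb⟩

section Complete

variable {Q : Type u} [CommRing Q] [IsLocalRing Q] [IsNoetherianRing Q]
  [IsAdicComplete (IsLocalRing.maximalIdeal Q) Q] [IsAlgClosed (IsLocalRing.ResidueField Q)]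
  {d : ℕ}

/-- In a finite commutative algebra over a complete local ring with algebraically closed residue
field, in which `d` is invertible, units have `d`-th roots. -/
theorem exists_pow_eq_of_isAdicComplete (hd : IsUnit (d : Q)) {S : Type v} [CommRing S]
    [Algebra Q S] [Module.Finite Q S] {a : S} (ha : IsUnit a) : ∃ b : S, b ^ d = a := by
  rcases Nat.eq_zero_or_pos d with rfl | hd0
  · have := hd.ne_zero
    simp at this
  set J := (IsLocalRing.maximalIdeal Q).map (algebraMap Q S) with hJ
  -- The `J`-adic filtration of `S` is its filtration by powers of the maximal ideal of `Q`.
  have : IsAdicComplete J S := (IsAdicComplete.map_algebraMap_iff _ _).2 (isAdicComplete_of_finite _ S)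
  have : HenselianRing S J := inferInstance
  let : Algebra (IsLocalRing.ResidueField Q) (S ⧸ J) :=
    (Ideal.quotientMap J (algebraMap Q S) Ideal.le_comap_map :
      Q ⧸ IsLocalRing.maximalIdeal Q →+* S ⧸ J).toAlgebra
  have : IsScalarTower Q (IsLocalRing.ResidueField Q) (S ⧸ J) :=
    IsScalarTower.of_algebraMap_eq fun _ => rfl
  have : Module.Finite Q (S ⧸ J) := Module.Finite.trans S _
  have : Module.Finite (IsLocalRing.ResidueField Q) (S ⧸ J) :=
    Module.Finite.of_restrictScalars_finite Q _ _
  have hdk : (d : IsLocalRing.ResidueField Q) ≠ 0 := by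
    simpa using (hd.map (IsLocalRing.residue Q)).ne_zero
  have haJ := ha.map (Ideal.Quotient.mk J)
  obtain ⟨b, hb⟩ := exists_pow_eq_of_isAlgClosed hdk haJ
  obtain ⟨b₀, rfl⟩ := Ideal.Quotient.mk_surjective b
  have hdS : IsUnit (d : S ⧸ J) := by simpa using hd.map (algebraMap Q (S ⧸ J))
  rw [← hb] at haJ
  obtain ⟨b, hb, -⟩ := HenselianRing.is_henselian (I := J) (Polynomial.X ^ d - Polynomial.C a)
    (Polynomial.monic_X_pow_sub_C a hd0.ne') b₀
    (by simpa [← Ideal.Quotient.eq_zero_iff_mem, sub_eq_zero] using hb)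
    (by simpa [Polynomial.derivative_X_pow] using
      And.intro hdS (((isUnit_pow_iff hd0.ne').1 haJ).pow (d - 1)))
  exact ⟨b, by simpa [Polynomial.IsRoot, sub_eq_zero] using hb⟩

/-- A unit of a finite algebra has a `d`-th root in its bicommutant. -/
theorem exists_pow_eq_commute (hd : IsUnit (d : Q)) {E : Type v} [Ring E] [Algebra Q E]
    [Module.Finite Q E] (a : Eˣ) :
    ∃ b : E, b ^ d = a ∧ ∀ x : E, Commute x a → Commute x b := by
  -- The bicommutant of `a` is commutative because it lies in the commutant of `a`; it is finite
  -- over `Q` as a submodule of a Noetherian module.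
  let C : Subalgebra Q E := Subalgebra.centralizer Q (Set.centralizer {(a : E)})
  have hC : ∀ x : E, x ∈ C ↔ ∀ y : E, Commute y a → Commute y x := by
    intro x
    simp only [C, Subalgebra.mem_centralizer_iff, Set.mem_centralizer_iff,
      Set.mem_singleton_iff, forall_eq]
    exact ⟨fun h y hy => h y hy.eq.symm, fun h y hy => h y hy.symm⟩
  have haC : (a : E) ∈ C := (hC _).2 fun _ h => h
  have hiC : ((a⁻¹ : Eˣ) : E) ∈ C := (hC _).2 fun _ h => h.units_inv_right
  let : CommRing C :=
    { (inferInstance : Ring C) with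
      mul_comm := fun x y => Subtype.ext
        ((hC y).1 y.2 x ((hC x).1 x.2 a (Commute.refl _)).symm).eq }
  have : IsNoetherian Q E := isNoetherian_of_isNoetherianRing_of_finite Q E
  have : Module.Finite Q C := inferInstanceAs (Module.Finite Q (Subalgebra.toSubmodule C))
  obtain ⟨b, hb⟩ := exists_pow_eq_of_isAdicComplete (Q := Q) hd (S := C) (a := ⟨a, haC⟩)
    (IsUnit.of_mul_eq_one ⟨_, hiC⟩ (Subtype.ext a.mul_inv))
  exact ⟨b, congrArg Subtype.val hb, (hC _).1 b.2⟩

end Complete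

/-! ### Operators commuting up to a root of unity, and the resulting idempotents. -/

/-- The geometric sum vanishes in `ℂ`, where the nonzero factor `ζ ^ i - 1` cancels, and `ρ` carries
this to `Q`, where `z ^ i - 1` could be a zero divisor. -/
theorem IsPrimitiveRootImage.sum_pow_eq_zero {Q : Type u} [CommRing Q] {d : ℕ} {z : Q}
    (hz : IsPrimitiveRootImage d z) {i : ℕ} (hi : ¬ d ∣ i) :
    ∑ j ∈ Finset.range d, (z ^ i) ^ j = 0 := by
  obtain ⟨ζ, hζ, ρ, rfl⟩ := hz
  simp only [← map_pow, ← map_sum]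
  convert map_zero ρ
  apply Subtype.val_injective
  simp only [AddSubmonoidClass.coe_finsetSum, SubmonoidClass.coe_pow, ZeroMemClass.coe_zero]
  have h1 : ζ ^ i - 1 ≠ 0 := sub_ne_zero.2 fun h => hi (hζ.dvd_of_pow_eq_one i h)
  have h2 := mul_geom_sum (ζ ^ i) d
  rw [pow_right_comm, hζ.pow_eq_one, one_pow, sub_self] at h2
  exact (mul_eq_zero.1 h2).resolve_left h1

theorem mul_pow_of_qcommute {R : Type*} [CommRing R] {E : Type*} [Ring E] [Algebra R E]
    {z : R} {a b : E} (h : a * b = z • (b * a)) (n : ℕ) : a * b ^ n = z ^ n • (b ^ n * a) := by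
  induction n with
  | zero => simp
  | succ n ih =>
    rw [pow_succ, ← mul_assoc, ih, smul_mul_assoc, mul_assoc, h, mul_smul_comm, smul_smul,
      mul_assoc, pow_succ]

theorem pow_mul_of_qcommute {R : Type*} [CommRing R] {E : Type*} [Ring E] [Algebra R E]
    {z : R} {a b : E} (h : a * b = z • (b * a)) (n : ℕ) : a ^ n * b = z ^ n • (b * a ^ n) := by
  induction n with
  | zero => simp
  | succ n ih =>
    rw [pow_succ', mul_assoc, ih, mul_smul_comm, ← mul_assoc, h, smul_mul_assoc, smul_smul,
      mul_assoc, pow_succ]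

/-- Normalizes `s` to order dividing `d`: `t = s * v` with `v` a `d`-th root of `s ^ (-d)`. As `a`
commutes with `s ^ d`, it commutes with the bicommutant element `v`, so the twisted relation
survives. The last clause later transfers degree `0` and compatibility with the structure map from
`s` to `t`. -/
theorem exists_pow_eq_one_of_qcommute {Q : Type u} [CommRing Q] [IsLocalRing Q]
    [IsNoetherianRing Q] [IsAdicComplete (IsLocalRing.maximalIdeal Q) Q]
    [IsAlgClosed (IsLocalRing.ResidueField Q)] {d : ℕ} (hd : IsUnit (d : Q)) {z : Q}
    (hz : z ^ d = 1) {E : Type v} [Ring E] [Algebra Q E] [Module.Finite Q E] (s : Eˣ) (a : E)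
    (h : a * s = z • (s * a)) :
    ∃ t : E, t ^ d = 1 ∧ a * t = z • (t * a) ∧ ∀ x : E, Commute x s → Commute x t := by
  obtain ⟨v, hv, hc⟩ := exists_pow_eq_commute hd ((s ^ d)⁻¹)
  have hc' : ∀ x : E, Commute x ((s : E) ^ d) → Commute x v := fun x hx =>
    hc x (Commute.units_inv_right (by simpa using hx))
  have hsv : Commute (s : E) v := hc' _ ((Commute.refl _).pow_right d)
  have hav : Commute a v := hc' _ (by
    have := mul_pow_of_qcommute h d
    rwa [hz, one_smul] at this)
  refine ⟨s * v, ?_, ?_, fun x hx => hx.mul_right (hc' x (hx.pow_right d))⟩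
  · rw [hsv.mul_pow, hv, ← Units.val_pow_eq_pow_val, Units.mul_inv]
  · rw [← mul_assoc, h, smul_mul_assoc, mul_assoc, hav.eq, mul_assoc]

section Average

variable {Q : Type u} [CommRing Q] {d : ℕ} {E : Type v} [Ring E] [Algebra Q E]

/-- The average of the powers of `t`, where `c` is an inverse of `d`. -/
def averagePow (c : Q) (d : ℕ) (t : E) : E := c • ∑ j ∈ Finset.range d, t ^ j

theorem averagePow_mul_self_right (c : Q) {t : E} (ht : t ^ d = 1) :
    averagePow c d t * t = averagePow c d t := by
  rw [averagePow, smul_mul_assoc, Finset.sum_mul]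
  congr 1
  -- Splitting off the first or the last term of the sum over `j ≤ d` removes `1` in both cases,
  -- since `t ^ d = 1`.
  have h := (Finset.sum_range_succ' (fun j => t ^ j) d).symm.trans
    (Finset.sum_range_succ (fun j => t ^ j) d)
  rw [pow_zero, ht] at h
  simpa only [← pow_succ] using add_right_cancel h

theorem averagePow_mul_pow (c : Q) {t : E} (ht : t ^ d = 1) (n : ℕ) :
    averagePow c d t * t ^ n = averagePow c d t := by
  induction n with
  | zero => simp
  | succ n ih => rw [pow_succ, ← mul_assoc, ih, averagePow_mul_self_right c ht]

theorem Commute.averagePow_right {x t : E} (h : Commute x t) (c : Q) :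
    Commute x (averagePow c d t) :=
  (Commute.sum_right _ _ _ fun j _ => h.pow_right j).smul_right c

theorem averagePow_mul_self {c : Q} (hc : c * d = 1) {t : E} (ht : t ^ d = 1) :
    averagePow c d t * averagePow c d t = averagePow c d t := by
  conv_lhs => rhs; rw [averagePow]
  rw [mul_smul_comm, Finset.mul_sum, Finset.sum_congr rfl fun n _ => averagePow_mul_pow c ht n]
  rw [Finset.sum_const, Finset.card_range, ← Nat.cast_smul_eq_nsmul Q, smul_smul, hc, one_smul]

theorem pow_mul_averagePow (c : Q) {t : E} (ht : t ^ d = 1) (n : ℕ) :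
    t ^ n * averagePow c d t = averagePow c d t := by
  rw [(((Commute.refl t).pow_left n).averagePow_right c).eq, averagePow_mul_pow c ht]

/-- The idempotent `e` absorbs powers of `t`, so `e a e = e a t ^ j e = y ^ j e a e` for every `j`;
summing over `j` gives `d • e a e = 0`. -/
theorem averagePow_mul_mul_averagePow_of_qcommute {c : Q} (hc : c * d = 1) {t a : E}
    (ht : t ^ d = 1) {y : Q} (hy : ∑ j ∈ Finset.range d, y ^ j = 0)
    (h : a * t = y • (t * a)) : averagePow c d t * a * averagePow c d t = 0 := by
  set e := averagePow c d t with he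
  have h1 : ∀ j : ℕ, e * a * e = y ^ j • (e * a * e) := fun j => by
    calc e * a * e = e * a * (t ^ j * e) := by rw [pow_mul_averagePow c ht]
      _ = e * (a * t ^ j) * e := by noncomm_ring
      _ = y ^ j • (e * t ^ j * a * e) := by
        rw [mul_pow_of_qcommute h, mul_smul_comm, smul_mul_assoc, ← mul_assoc]
      _ = y ^ j • (e * a * e) := by rw [averagePow_mul_pow c ht]
  have h2 : (d : Q) • (e * a * e) = 0 := by
    rw [Nat.cast_smul_eq_nsmul, ← Finset.card_range d, ← Finset.sum_const,
      Finset.sum_congr rfl fun j _ => h1 j, ← Finset.sum_smul, hy, zero_smul]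
  rw [← one_smul Q (e * a * e), ← hc, mul_smul, h2, smul_zero]

/-- Fourier inversion on `ℤ/d`: conjugation by `a ^ i` multiplies `t ^ j` by `z ^ (i * j)`, and
summing over `i` kills every term but `j = 0`. -/
theorem sum_conj_averagePow {c : Q} (hc : c * d = 1) {z : Q} (hz : IsPrimitiveRootImage d z)
    (t : E) (a : Eˣ) (h : a * t = z • (t * a)) :
    ∑ i ∈ Finset.range d, (a : E) ^ i * averagePow c d t * ((a⁻¹ : Eˣ) : E) ^ i = 1 := by
  have h1 : ∀ i j : ℕ, (a : E) ^ i * t ^ j * ((a⁻¹ : Eˣ) : E) ^ i = (z ^ j) ^ i • t ^ j := by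
    intro i j
    rw [pow_mul_of_qcommute (mul_pow_of_qcommute h j) i, smul_mul_assoc, mul_assoc,
      ← Units.val_pow_eq_pow_val, ← Units.val_pow_eq_pow_val, inv_pow, Units.mul_inv, mul_one]
  simp only [averagePow, mul_smul_comm, smul_mul_assoc, Finset.mul_sum, Finset.sum_mul, h1]
  rw [← Finset.smul_sum, Finset.sum_comm]
  simp only [← Finset.sum_smul]
  rcases Nat.eq_zero_or_pos d with rfl | hd
  -- For `d = 0` the relation `c * d = 1` makes `Q`, and hence `E`, trivial.
  · have : (1 : Q) = 0 := by simpa using hc.symm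
    rw [← one_smul Q (1 : E), this]
    simp
  rw [Finset.sum_eq_single_of_mem 0 (Finset.mem_range.2 hd)]
  · simp [smul_smul, hc]
  · intro j hj hj0
    rw [hz.sum_pow_eq_zero (fun hdvd => hj0 (Nat.eq_zero_of_dvd_of_lt hdvd
      (Finset.mem_range.1 hj))), zero_smul]

/-- Orthogonality of the conjugates of `e`: for `i ≠ j` the middle factor is `a ^ (j - i)`, which
commutes with `t` up to the nontrivial root of unity `z ^ (j - i)`. -/
theorem averagePow_mul_inv_pow_mul_pow_mul_averagePow {c : Q} (hc : c * d = 1) {z : Q}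
    (hz : IsPrimitiveRootImage d z) {t : E} (ht : t ^ d = 1) (a : Eˣ)
    (h : a * t = z • (t * a)) {i j : ℕ} (hi : i < d) (hj : j < d) :
    averagePow c d t * (((a⁻¹ : Eˣ) : E) ^ i * (a : E) ^ j) * averagePow c d t =
      if i = j then averagePow c d t else 0 := by
  have key : ∀ n : ℕ, 0 < n → n < d → averagePow c d t * (a : E) ^ n * averagePow c d t = 0 :=
    fun n hn hnd => averagePow_mul_mul_averagePow_of_qcommute hc ht
      (hz.sum_pow_eq_zero (Nat.not_dvd_of_pos_of_lt hn hnd)) (pow_mul_of_qcommute h n)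
  split_ifs with hij
  · subst hij
    rw [← Units.val_pow_eq_pow_val, ← Units.val_pow_eq_pow_val, inv_pow, Units.inv_mul, mul_one,
      averagePow_mul_self hc ht]
  rcases Nat.lt_or_gt_of_ne hij with hlt | hlt
  · rw [← key (j - i) (by omega) (by omega)]
    congr 2
    obtain ⟨k, rfl⟩ := Nat.exists_eq_add_of_lt hlt
    rw [add_assoc, pow_add, ← mul_assoc, Nat.add_sub_cancel_left, ← Units.val_pow_eq_pow_val,
      ← Units.val_pow_eq_pow_val, inv_pow, Units.inv_mul, one_mul]
  · have hn : ¬ d ∣ (d - (i - j)) := Nat.not_dvd_of_pos_of_lt (by omega) (by omega)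
    have hn' : ((a⁻¹ : Eˣ) : E) ^ i * (a : E) ^ j = ((a⁻¹ : Eˣ) : E) ^ (i - j) := by
      have : a⁻¹ ^ i * a ^ j = a⁻¹ ^ (i - j) := by
        rw [inv_pow, inv_pow, pow_sub a hlt.le, mul_inv_rev, inv_inv,
          ((Commute.refl a).pow_pow j i).inv_right.eq]
      exact_mod_cast congrArg Units.val this
    rw [hn']
    -- Here `z ^ (d - 1)` plays the role of `z⁻¹`.
    have hinv : ((a⁻¹ : Eˣ) : E) * t = z ^ (d - 1) • (t * ((a⁻¹ : Eˣ) : E)) := by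
      have h2 : t * ((a⁻¹ : Eˣ) : E) = z • (((a⁻¹ : Eˣ) : E) * t) := by
        calc t * ((a⁻¹ : Eˣ) : E) = ((a⁻¹ : Eˣ) : E) * (a * t) * ((a⁻¹ : Eˣ) : E) := by
              rw [← mul_assoc, Units.inv_mul, one_mul]
          _ = z • (((a⁻¹ : Eˣ) : E) * t) := by
              rw [h, mul_smul_comm, smul_mul_assoc, mul_assoc, mul_assoc t, Units.mul_inv, mul_one]
      rw [h2, smul_smul, ← pow_succ, Nat.sub_add_cancel (by omega), hz.pow_eq_one, one_smul]
    refine averagePow_mul_mul_averagePow_of_qcommute hc ht ?_ (pow_mul_of_qcommute hinv (i - j))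
    have hpow : (z ^ (d - 1)) ^ (i - j) = z ^ (d - (i - j)) := by
      rw [← pow_mul]
      have : (d - 1) * (i - j) = d * (i - j - 1) + (d - (i - j)) := by
        obtain ⟨k, hk⟩ : ∃ k, i - j = k + 1 := ⟨i - j - 1, by omega⟩
        obtain ⟨l, rfl⟩ : ∃ l, d = k + 1 + l := ⟨d - (k + 1), by omega⟩
        rw [hk]
        simp only [Nat.add_sub_cancel, Nat.add_sub_cancel_left]
        rw [show k + 1 + l - 1 = k + l by omega]
        ring
      rw [this, pow_add, pow_mul, hz.pow_eq_one, one_pow, one_mul]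
    rw [hpow]
    exact hz.sum_pow_eq_zero hn

end Average

/-! ### Graded endomorphisms and splitting off shifts. -/

namespace MatrixFactorization

variable {Q : Type u} [CommRing Q] {d : ℕ} {f g : Q}

/-- An endomorphism of the underlying module of degree `n`. -/
def HasDegree (X : MatrixFactorization.{u, v} Q d f) (n : ZMod d)
    (a : Module.End Q X.carrier) : Prop :=
  ∀ k, ∀ x ∈ X.piece k, a x ∈ X.piece (k + n)

theorem HasDegree.mul {X : MatrixFactorization.{u, v} Q d f} {m n : ZMod d}
    {a b : Module.End Q X.carrier} (ha : X.HasDegree m a) (hb : X.HasDegree n b) :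
    X.HasDegree (m + n) (a * b) := fun k x hx => by
  have := ha _ _ (hb k x hx)
  rwa [add_assoc, add_comm n] at this

theorem hasDegree_one (X : MatrixFactorization.{u, v} Q d f) : X.HasDegree 0 1 :=
  fun k x hx => by simpa using hx

theorem HasDegree.pow {X : MatrixFactorization.{u, v} Q d f} {m : ZMod d}
    {a : Module.End Q X.carrier} (ha : X.HasDegree m a) (n : ℕ) :
    X.HasDegree (n * m) (a ^ n) := by
  induction n with
  | zero => simpa using X.hasDegree_one
  | succ n ih =>
    rw [pow_succ]
    convert ih.mul ha using 1
    push_cast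
    ring

/-- Together with its converse below, this turns degree `0` into a commutation condition, which
passes to elements of a bicommutant. -/
theorem HasDegree.commute_proj {X : MatrixFactorization.{u, v} Q d f}
    {a : Module.End Q X.carrier} (ha : X.HasDegree 0 a) (k : ZMod d) :
    Commute a (X.proj k) := by
  refine X.hom_ext_piece fun l x hx => ?_
  have hax := ha l x hx
  rw [add_zero] at hax
  simp only [Module.End.mul_apply]
  by_cases h : l = k
  · subst h
    rw [X.proj_of_mem hx, X.proj_of_mem hax]
  · rw [X.proj_of_mem_ne h hx, X.proj_of_mem_ne h hax, map_zero]

theorem hasDegree_zero_of_commute_proj {X : MatrixFactorization.{u, v} Q d f}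
    {a : Module.End Q X.carrier} (ha : ∀ k, Commute a (X.proj k)) : X.HasDegree 0 a := by
  intro k x hx
  have h := LinearMap.congr_fun (ha k).eq x
  simp only [Module.End.mul_apply, X.proj_of_mem hx] at h
  rw [h, add_zero]
  exact X.proj_mem _ _

theorem tensorPiece_map {X : MatrixFactorization.{u, v} Q d f}
    {Y : MatrixFactorization.{u, v} Q d g} {m n : ZMod d} {a : Module.End Q X.carrier}
    {b : Module.End Q Y.carrier} (ha : X.HasDegree m a) (hb : Y.HasDegree n b) (k : ZMod d)
    (t : X.carrier ⊗[Q] Y.carrier) (ht : t ∈ X.tensorPiece Y k) :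
    TensorProduct.map a b t ∈ X.tensorPiece Y (k + (m + n)) := by
  have : X.tensorPiece Y k ≤ (X.tensorPiece Y (k + (m + n))).comap (TensorProduct.map a b) :=
    X.tensorPiece_le Y k _ fun i j hij x hx y hy => by
      rw [Submodule.mem_comap, TensorProduct.map_tmul]
      exact X.tmul_mem_tensorPiece Y (by rw [← hij]; ring) (ha i x hx) (hb j y hy)
  exact this ht

variable [NeZero d]

theorem hasDegree_twist (X : MatrixFactorization.{u, v} Q d f) (z : Q) :
    X.HasDegree 0 (X.twist z) := fun k x hx => by
  rw [X.twist_of_mem z hx, add_zero]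
  exact Submodule.smul_mem _ _ hx

theorem HasDegree.mul_twist {X : MatrixFactorization.{u, v} Q d f}
    {a : Module.End Q X.carrier} (ha : X.HasDegree (-1) a) {z : Q} (hz : z ^ d = 1) :
    a * X.twist z = z • (X.twist z * a) := by
  refine X.hom_ext_piece fun k x hx => ?_
  simp only [Module.End.mul_apply, LinearMap.smul_apply, X.twist_of_mem z hx,
    X.twist_of_mem z (ha k x hx), map_smul, smul_smul, ← pow_succ']
  congr 1
  rw [pow_eq_pow_mod k.val hz, pow_eq_pow_mod (_ + 1) hz]
  congr 1
  change k.val ≡ _ [MOD d]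
  rw [← ZMod.natCast_eq_natCast_iff]
  simp

/-- The image of an idempotent endomorphism, as a matrix factorization. -/
noncomputable def image (X : MatrixFactorization.{u, v} Q d f) (e : Module.End Q X.carrier)
    (he : e * e = e) (hdeg : X.HasDegree 0 e) (hφ : Commute X.φ e) :
    MatrixFactorization.{u, v} Q d f where
  carrier := LinearMap.range e
  projective := Module.Projective.of_split (LinearMap.range e).subtype e.rangeRestrict (by
    ext ⟨_, x, rfl⟩
    exact LinearMap.congr_fun he x)
  piece k := (X.piece k).comap (LinearMap.range e).subtype
  isInternal := by
    have hmem : ∀ k, ∀ x ∈ LinearMap.range e, X.proj k x ∈ LinearMap.range e := by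
      rintro k _ ⟨x, rfl⟩
      exact ⟨X.proj k x, LinearMap.congr_fun (hdeg.commute_proj k).eq x⟩
    refine isInternal_of_projections _ (fun k => (X.proj k).restrict (hmem k)) ?_ ?_ ?_ ?_
    · exact fun k x => X.proj_mem k x
    · exact fun k x hx => Subtype.ext (X.proj_of_mem hx)
    · exact fun k l hkl x hx => Subtype.ext (X.proj_of_mem_ne hkl hx)
    · intro x
      apply Subtype.ext
      rw [AddSubmonoidClass.coe_finsetSum]
      exact X.sum_proj x
  φ := X.φ.restrict (p := LinearMap.range e) (q := LinearMap.range e) (by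
    rintro _ ⟨x, rfl⟩
    exact ⟨X.φ x, (LinearMap.congr_fun hφ.eq x).symm⟩)
  φ_mem k x hx := X.φ_mem k x hx
  φ_pow := by
    ext x
    rw [Module.End.pow_restrict, LinearMap.coe_restrict_apply, X.φ_pow]
    rfl

/-- With `Z` the image of `e`, the maps `e * b i : W → Tⁱ Z` and `a i : Tⁱ Z → W` are the
projections and inclusions of a direct sum: `hba` and `hab` are the two biproduct identities. The
degrees `∓i` of `a i` and `b i` account for the shift. -/
theorem exists_iso_directSum_shift (W : MatrixFactorization.{u, v} Q d f)
    (e : Module.End Q W.carrier) (he : e * e = e) (hdeg : W.HasDegree 0 e)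
    (hφ : Commute W.φ e) (a b : ZMod d → Module.End Q W.carrier)
    (ha : ∀ i, W.HasDegree (-i) (a i)) (hb : ∀ i, W.HasDegree i (b i))
    (haφ : ∀ i, Commute W.φ (a i)) (hbφ : ∀ i, Commute W.φ (b i))
    (hba : ∀ i j, e * (b i * a j) * e = if i = j then e else 0)
    (hab : ∑ i, a i * e * b i = 1) :
    ∃ Z : MatrixFactorization.{u, v} Q d f,
      Nonempty (W ≅ directSum fun i : ZMod d => Z.shift i) := by
  have hmap : ∀ i (x : W.carrier), W.φ (a i x) = a i (W.φ x) :=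
    fun i x => LinearMap.congr_fun (haφ i).eq x
  have hmap' : ∀ i (x : W.carrier), W.φ (e (b i x)) = e (b i (W.φ x)) :=
    fun i x => LinearMap.congr_fun (hφ.mul_right (hbφ i)).eq x
  let Z := W.image e he hdeg hφ
  let D := directSum fun i : ZMod d => Z.shift i
  let F : W ⟶ D :=
    { toLinearMap := LinearMap.pi fun i => e.rangeRestrict ∘ₗ b i
      map_mem := fun k x hx => by
        refine Submodule.mem_pi.2 fun i _ => ?_
        have := hdeg _ _ (hb i k x hx)
        rwa [add_zero] at this
      comm := by
        ext x
        funext i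
        exact Subtype.ext (hmap' i x).symm }
  let G : D ⟶ W :=
    { toLinearMap := ∑ i, a i ∘ₗ (LinearMap.range e).subtype ∘ₗ
        LinearMap.proj (R := Q) (φ := fun _ : ZMod d => LinearMap.range e) i
      map_mem := fun k x hx => by
        rw [LinearMap.sum_apply]
        refine Submodule.sum_mem _ fun i _ => ?_
        have := ha i _ _ (Submodule.mem_pi.1 hx i trivial)
        rwa [add_neg_cancel_right] at this
      comm := by
        ext x
        change (∑ i, a i ∘ₗ _) _ = W.φ ((∑ i, a i ∘ₗ _) x)
        rw [LinearMap.sum_apply, LinearMap.sum_apply, map_sum]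
        exact Finset.sum_congr rfl fun i _ => (hmap i _).symm }
  refine ⟨Z, ⟨⟨F, G, ?_, ?_⟩⟩⟩
  · apply Hom.ext
    ext x
    change (∑ i, a i ∘ₗ _) _ = x
    have := LinearMap.congr_fun hab x
    rw [LinearMap.sum_apply] at this ⊢
    exact this
  · apply Hom.ext
    refine LinearMap.ext fun (y : ZMod d → LinearMap.range e) => ?_
    funext i
    apply Subtype.ext
    change e (b i ((∑ j, a j ∘ₗ (LinearMap.range e).subtype ∘ₗ
      LinearMap.proj (R := Q) (φ := fun _ : ZMod d => LinearMap.range e) j :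
        (ZMod d → LinearMap.range e) →ₗ[Q] W.carrier) y)) = (y i : W.carrier)
    rw [LinearMap.sum_apply, map_sum, map_sum]
    have hex : ∀ j, e (y j : W.carrier) = y j := by
      intro j
      obtain ⟨w, hw⟩ := (y j).2
      rw [← hw]
      exact LinearMap.congr_fun he w
    have h : ∀ j, e (b i (a j (y j : W.carrier))) = if i = j then (y j : W.carrier) else 0 := by
      intro j
      have := LinearMap.congr_fun (hba i j) (y j : W.carrier)
      simp only [Module.End.mul_apply, hex] at this
      rw [this]
      split_ifs
      · exact hex j
      · rfl
    exact (Finset.sum_congr rfl fun j _ => h j).trans (by simp)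

end MatrixFactorization

/-! ### From shift-invariance to the decomposition. -/

namespace MatrixFactorization

variable {Q : Type u} [CommRing Q] {d : ℕ} {f g : Q}

/-- `TX` and `X` share their module and structure map and differ only in grading, so the isomorphism
is an automorphism of one module, sending `Xₖ₊₁` to `Xₖ`. -/
theorem exists_unit_of_shift_iso {X : MatrixFactorization.{u, v} Q d f} (i : X.shift 1 ≅ X) :
    ∃ a : (Module.End Q X.carrier)ˣ, Commute X.φ a ∧ X.HasDegree (-1) a ∧
      X.HasDegree 1 ((a⁻¹ : (Module.End Q X.carrier)ˣ) : Module.End Q X.carrier) := by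
  refine ⟨⟨i.hom.toLinearMap, i.inv.toLinearMap, congrArg Hom.toLinearMap i.inv_hom_id,
    congrArg Hom.toLinearMap i.hom_inv_id⟩, i.hom.comm.symm, fun k x hx => ?_,
    fun k x hx => i.inv.map_mem k x hx⟩
  refine i.hom.map_mem (k + -1) x ?_
  change x ∈ X.piece (k + -1 + 1)
  rwa [neg_add_cancel_right]

variable [NeZero d]

/-- If `W` has an automorphism `s` of degree `0` and an automorphism `a` of degree `-1` that
commute up to a primitive `d`-th root of unity, then `W` is the sum of the shifts of a summand. -/
theorem exists_iso_directSum_shift_of_qcommute {Q : Type u} [CommRing Q] [IsLocalRing Q]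
    [IsNoetherianRing Q] [IsAdicComplete (IsLocalRing.maximalIdeal Q) Q]
    [IsAlgClosed (IsLocalRing.ResidueField Q)] (hd : IsUnit (d : Q)) {z : Q}
    (hz : IsPrimitiveRootImage d z) {f : Q} (W : MatrixFactorization.{u, v} Q d f)
    (a s : (Module.End Q W.carrier)ˣ) (ha : W.HasDegree (-1) a)
    (ha' : W.HasDegree 1 ((a⁻¹ : (Module.End Q W.carrier)ˣ) : Module.End Q W.carrier))
    (hs : W.HasDegree 0 s) (haφ : Commute W.φ a) (hsφ : Commute W.φ s)
    (h : (a : Module.End Q W.carrier) * s = z • (s * a)) :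
    ∃ Z : MatrixFactorization.{u, v} Q d f,
      Nonempty (W ≅ directSum fun i : ZMod d => Z.shift i) := by
  obtain ⟨c, hc⟩ := hd.exists_left_inv
  -- Projective modules over a local ring are free; for `W` finite free, its endomorphism algebra is
  -- finite over `Q`, as root extraction requires.
  have : Module.Free Q W.carrier := Module.free_of_flat_of_isLocalRing
  obtain ⟨t, ht, hat, htc⟩ := exists_pow_eq_one_of_qcommute hd hz.pow_eq_one s _ h
  have htproj : ∀ k, Commute (W.proj k) t := fun k => htc _ (hs.commute_proj k).symm
  refine W.exists_iso_directSum_shift (averagePow c d t) (averagePow_mul_self hc ht)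
    (hasDegree_zero_of_commute_proj fun k => ((htproj k).averagePow_right c).symm)
    ((htc _ hsφ).averagePow_right c) (fun i => (a : Module.End Q W.carrier) ^ i.val)
    (fun i => ((a⁻¹ : (Module.End Q W.carrier)ˣ) : Module.End Q W.carrier) ^ i.val)
    (fun i => by simpa using ha.pow i.val) (fun i => by simpa using ha'.pow i.val)
    (fun i => haφ.pow_right _) (fun i => haφ.units_inv_right.pow_right _)
    (fun i j => ?_) ?_
  · rw [averagePow_mul_inv_pow_mul_pow_mul_averagePow hc hz ht a hat (ZMod.val_lt i)
      (ZMod.val_lt j)]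
    simp [(ZMod.val_injective d).eq_iff]
  · rw [← sum_conj_averagePow hc hz t a hat, Finset.sum_range]
    -- Once `d` is a successor, `ZMod d` is `Fin d` by definition and `ZMod.val` is the coercion.
    obtain ⟨n, rfl⟩ := Nat.exists_eq_succ_of_ne_zero (NeZero.ne d)
    rfl

/-- The tensor product of two units of endomorphism algebras. -/
def tensorUnit {M N : Type*} [AddCommGroup M] [Module Q M] [AddCommGroup N] [Module Q N]
    (a : (Module.End Q M)ˣ) (b : (Module.End Q N)ˣ) : (Module.End Q (M ⊗[Q] N))ˣ where
  val := TensorProduct.map a b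
  inv := TensorProduct.map (a⁻¹ : (Module.End Q M)ˣ).val (b⁻¹ : (Module.End Q N)ˣ).val
  val_inv := by rw [← TensorProduct.map_mul, a.mul_inv, b.mul_inv, TensorProduct.map_one]
  inv_val := by rw [← TensorProduct.map_mul, a.inv_mul, b.inv_mul, TensorProduct.map_one]

end MatrixFactorization

/-! ### The tensor product. -/

open MatrixFactorization

theorem corollary4p5 {Q : Type u} [CommRing Q] [IsRegularLocalRing Q]
    [IsAdicComplete (IsLocalRing.maximalIdeal Q) Q]
    [IsAlgClosed (IsLocalRing.ResidueField Q)]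
    (d : ℕ) [NeZero d] (hd : 2 ≤ d)
    (hchar : ¬ ringChar (IsLocalRing.ResidueField Q) ∣ d)
    (ω : Q) (hω : IsPrimitiveRootImage (2 * d) ω)
    (f g : Q) (hf : f ∈ IsLocalRing.maximalIdeal Q ^ 2) (hf0 : f ≠ 0)
    (hg : g ∈ IsLocalRing.maximalIdeal Q ^ 2) (hg0 : g ≠ 0)
    (X : MatrixFactorization.{u, v} Q d f) (Y : MatrixFactorization.{u, v} Q d g)
    (hX : Nonempty (X.shift 1 ≅ X)) (hY : Nonempty (Y.shift 1 ≅ Y)) :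
    ∃ Z : MatrixFactorization.{u, v} Q d (f + g),
      Nonempty (MatrixFactorization.tensor hω.sq X Y ≅
        MatrixFactorization.directSum fun i : ZMod d => Z.shift i) := by
  have hdu : IsUnit (d : Q) := by
    rw [← IsLocalRing.residue_ne_zero_iff_isUnit, map_natCast]
    exact fun h => hchar ((ringChar.spec _ d).1 h)
  obtain ⟨α, hαφ, hα, hα'⟩ := exists_unit_of_shift_iso hX.some
  obtain ⟨β, hβψ, hβ, hβ'⟩ := exists_unit_of_shift_iso hY.some
  have hz := hω.sq
  set z := ω ^ 2
  have hz1 := hz.pow_eq_one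
  let ρ : (Module.End Q Y.carrier)ˣ := Units.ofPowEqOne _ d (Y.twist_pow hz1) (NeZero.ne d)
  have hρ : (ρ : Module.End Q Y.carrier) = Y.twist z := rfl
  have hρ0 : Y.HasDegree 0 ρ := Y.hasDegree_twist z
  have hρ0' : Y.HasDegree 0 ((ρ⁻¹ : (Module.End Q Y.carrier)ˣ) : Module.End Q Y.carrier) :=
    hasDegree_zero_of_commute_proj fun k => (hρ0.commute_proj k).symm.units_inv_right.symm
  -- The plain `α ⊗ 1` fails to commute with the summand `x ⊗ y ↦ z ^ |x| x ⊗ ψ y` by a factor `z`;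
  -- the factor `ρ`, which commutes with `ψ` only up to `z`, compensates.
  let A : (Module.End Q (X.carrier ⊗[Q] Y.carrier))ˣ := tensorUnit α ρ
  let B : (Module.End Q (X.carrier ⊗[Q] Y.carrier))ˣ := tensorUnit 1 β
  have hA := tensorPiece_map hα hρ0
  have hA' := tensorPiece_map hα' hρ0'
  have hB' := tensorPiece_map X.hasDegree_one hβ'
  rw [add_zero] at hA hA'
  rw [zero_add] at hB'
  have hAv : A.val = TensorProduct.map α.val ρ.val := rfl
  have hBv : B.val = TensorProduct.map 1 β.val := rfl
  have hψ1 : Y.HasDegree (-1) Y.φ := fun k x hx => by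
    simpa [sub_eq_add_neg] using Y.φ_mem k x hx
  have hAφ : Commute (tensorMap z X Y) A := by
    rw [tensorMap, ← Module.End.one_eq_id]
    refine Commute.add_left ?_ ?_
    · rw [commute_iff_eq, hAv, ← TensorProduct.map_mul, ← TensorProduct.map_mul, hαφ.eq,
        one_mul, mul_one]
    · rw [commute_iff_eq, hAv, ← TensorProduct.map_mul, ← TensorProduct.map_mul, hρ,
        hψ1.mul_twist hz1, hα.mul_twist hz1, TensorProduct.map_smul_left,
        TensorProduct.map_smul_right]
  have hBφ : Commute (tensorMap z X Y) B := by
    rw [tensorMap, ← Module.End.one_eq_id]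
    refine Commute.add_left ?_ ?_
    · rw [commute_iff_eq, hBv, ← TensorProduct.map_mul, ← TensorProduct.map_mul, one_mul, mul_one,
        one_mul, mul_one]
    · rw [commute_iff_eq, hBv, ← TensorProduct.map_mul, ← TensorProduct.map_mul, hβψ.eq, one_mul,
        mul_one]
  have hBA : B.val * A.val = z • (A.val * B.val) := by
    rw [hAv, hBv, ← TensorProduct.map_mul, ← TensorProduct.map_mul, hρ, hβ.mul_twist hz1,
      one_mul, mul_one, TensorProduct.map_smul_right]
  have h : A.val * B⁻¹.val = z • (B⁻¹.val * A.val) := by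
    refine B.isUnit.mul_left_cancel (B.isUnit.mul_right_cancel ?_)
    rw [mul_assoc, mul_assoc, Units.inv_mul, mul_one, hBA, mul_smul_comm, smul_mul_assoc,
      ← mul_assoc, Units.mul_inv, one_mul]
  -- Both `A` and `B` have degree `-1`, so the quotient has degree `0`, while the factor `B⁻¹` keeps
  -- the relation with `A` up to `z`.
  have hs : (tensor hz X Y).HasDegree (1 + -1) (B⁻¹ * A).val :=
    HasDegree.mul (X := tensor hz X Y) hB' hA
  rw [add_neg_cancel] at hs
  have hAs : A.val * (B⁻¹ * A).val = z • ((B⁻¹ * A).val * A.val) := by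
    rw [Units.val_mul, ← mul_assoc, h, smul_mul_assoc]
  exact (tensor hz X Y).exists_iso_directSum_shift_of_qcommute hdu hz A (B⁻¹ * A) hA hA' hs hAφ
    (hBφ.units_inv_right.mul_right hAφ) hAs
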